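/- Let $q$ be a complex number with $|q|<1$. Write $(a;q)_n=\prod_{i=0}^{n-1}(1-aq^i)$, $(a;q)_\infty=\prod_{i=0}^{\infty}(1-aq^i)$ and $\phi(q)=\sum_{n=-\infty}^{\infty}q^{n^2}$. Then all series and products below converge, none of the denominators vanishes, and $$ \frac{\phi^3(-q)}{\phi(-q^3)}=1-\frac{6}{(-q;q^3)_\infty}\sum_{n=1}^{\infty}\frac{n\,q^{(3n^2-n)/2}}{(q^3;q^3)_n}+\frac{6}{(-q^2;q^3)_\infty}\sum_{n=1}^{\infty}\frac{n\,q^{(3n^2+n)/2}}{(q^3;q^3)_n} $$ $$ =1+6(-q;q^3)_\infty\sum_{n=1}^{\infty}\frac{n(-1)^nq^{n}}{(q^3;q^3)_n}-6(-q^2;q^3)_\infty\sum_{n=1}^{\infty}\frac{n(-1)^nq^{2n}}{(q^3;q^3)_n}. $$ -/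

import Mathlib

noncomputable section

/-- The finite `q`-shifted factorial `(a;q)_n = (1 - a)(1 - aq)⋯(1 - aq^(n-1))`. -/
def qPoch (a q : ℂ) (n : ℕ) : ℂ := ∏ i ∈ Finset.range n, (1 - a * q ^ i)

/-- The infinite `q`-shifted factorial `(a;q)_∞ = (1 - a)(1 - aq)(1 - aq^2)⋯`. -/
def qPochInf (a q : ℂ) : ℂ := ∏' i : ℕ, (1 - a * q ^ i)

/-- Ramanujan's theta function `φ(q) = ∑_{n ∈ ℤ} q^(n^2)`. -/
def ramanujanPhi (q : ℂ) : ℂ := ∑' n : ℤ, q ^ (n ^ 2)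

end

open Filter Topology

/-! ### Convergence and non-vanishing of q-shifted factorials -/

section Pochhammer

variable {p x : ℂ}

/-! Put `p = q^3` and let `L(x)` be `x d/dx` of `log (-x;p)_∞`. By Euler's two expansions, of
`(-x;p)_∞` and of its reciprocal, `L(x)` is a series in either of two ways (`gaussEulerDeriv_div`),
so both identities say that the quotient equals `1 - 6 L(q) + 6 L(q^2)`.

The Jacobi triple product and its `z d/dz` derivative (`tsum_triple`, `tsum_mul_triple`) at `z = q`
turn `L(q) - L(q^2)` into the ratio of `∑ n q^(n(3n-1)/2)` to `∑ q^(n(3n-1)/2)`. It remains to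
evaluate `∑ (1 - 6n) q^(n(3n-1)/2)`, which is `qPochInf_cube_mul_ramanujanPhi`.

For that, multiply the vanishing series `∑ (-1)^m q^(m(m-1)/2)` by `φ(-q) = ∑ (-1)^n q^(n^2)` and
weight the terms by `m + 2n`. Only the derivative of the vanishing factor survives, giving
`-(q;q)_∞^3 φ(-q)`. On the other hand `(1,1)` and `(-2,1)` are orthogonal for the form `m^2/2 + n^2`
and span a sublattice of index 3, so on each class of `m + 2n` mod 3 the double sum factors into two
theta series. Product manipulations finish the proof (`ramanujanPhi_cube_div`).

No derivative is taken analytically: `x d/dx` acts termwise as the weight `n`, and its identities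
come from `x ↦ x p` functional equations. -/

lemma qPoch_succ (x p : ℂ) (n : ℕ) : qPoch x p (n + 1) = qPoch x p n * (1 - x * p ^ n) :=
  Finset.prod_range_succ _ _

@[simp] lemma qPoch_zero (x p : ℂ) : qPoch x p 0 = 1 := rfl

lemma summable_mul_pow (hp : ‖p‖ < 1) (x : ℂ) : Summable fun i : ℕ => ‖-(x * p ^ i)‖ := by
  simpa using (summable_geometric_of_lt_one (norm_nonneg _) hp).mul_left ‖x‖

lemma multipliable_qPoch (hp : ‖p‖ < 1) (x : ℂ) : Multipliable fun i : ℕ => 1 - x * p ^ i := by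
  simpa [sub_eq_add_neg] using multipliable_one_add_of_summable (summable_mul_pow hp x)

lemma tendsto_qPoch (hp : ‖p‖ < 1) (x : ℂ) :
    Tendsto (qPoch x p) atTop (𝓝 (qPochInf x p)) :=
  (multipliable_qPoch hp x).hasProd.tendsto_prod_nat

lemma one_sub_ne_zero_of_norm_lt {y : ℂ} (hy : ‖y‖ < 1) : 1 - y ≠ 0 := by
  intro h
  rw [← sub_eq_zero.1 h] at hy
  simp at hy

lemma norm_mul_pow_lt_one (hp : ‖p‖ < 1) (hx : ‖x‖ < 1) (n : ℕ) : ‖x * p ^ n‖ < 1 := by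
  rw [norm_mul, norm_pow]
  exact (mul_le_of_le_one_right (norm_nonneg _) (pow_le_one₀ (norm_nonneg _) hp.le)).trans_lt hx

lemma qPoch_ne_zero (hp : ‖p‖ < 1) (hx : ‖x‖ < 1) (n : ℕ) : qPoch x p n ≠ 0 :=
  Finset.prod_ne_zero_iff.2 fun i _ => one_sub_ne_zero_of_norm_lt (norm_mul_pow_lt_one hp hx i)

lemma qPochInf_ne_zero (hp : ‖p‖ < 1) (hx : ‖x‖ < 1) : qPochInf x p ≠ 0 := by
  have := tprod_one_add_ne_zero_of_summable (f := fun i : ℕ => -(x * p ^ i))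
    (fun i => by
      simpa [sub_eq_add_neg] using one_sub_ne_zero_of_norm_lt (norm_mul_pow_lt_one hp hx i))
    (summable_mul_pow hp x)
  simpa [qPochInf, sub_eq_add_neg] using this

lemma tendsto_inv_qPoch (hp : ‖p‖ < 1) :
    Tendsto (fun n => (qPoch p p n)⁻¹) atTop (𝓝 (qPochInf p p)⁻¹) :=
  (tendsto_qPoch hp p).inv₀ (qPochInf_ne_zero hp hp)

lemma exists_norm_inv_qPoch_le (hp : ‖p‖ < 1) : ∃ C : ℝ, 0 ≤ C ∧ ∀ n, ‖(qPoch p p n)⁻¹‖ ≤ C := by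
  obtain ⟨C, hC⟩ := (tendsto_inv_qPoch hp).norm.bddAbove_range
  exact ⟨C, (norm_nonneg _).trans (hC ⟨0, rfl⟩), fun n => hC ⟨n, rfl⟩⟩

end Pochhammer

/-! ### Euler's two series and their logarithmic derivatives -/

section EulerSeries

variable {p x : ℂ}

/-- If `∑ c n * x ^ n` converges absolutely then its value at `p ^ k * x` tends to `c 0`. -/
lemma tendsto_tsum_mul_pow_atTop (hp : ‖p‖ < 1) {c : ℕ → ℂ}
    (hc : Summable fun n => ‖c n * x ^ n‖) :
    Tendsto (fun k : ℕ => ∑' n, c n * (x * p ^ k) ^ n) atTop (𝓝 (c 0)) := by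
  have h0 : c 0 = ∑' n, if n = 0 then c 0 else 0 := by rw [tsum_ite_eq]
  rw [h0]
  refine tendsto_tsum_of_dominated_convergence hc (fun n => ?_) (Eventually.of_forall fun k n => ?_)
  · rcases eq_or_ne n 0 with rfl | hn
    · simp
    · have h1 : Tendsto (fun k : ℕ => c n * (x * p ^ k) ^ n) atTop (𝓝 (c n * (x * 0) ^ n)) :=
        (((tendsto_pow_atTop_nhds_zero_of_norm_lt_one hp).const_mul x).pow n).const_mul _
      simpa [hn] using h1
  · rw [norm_mul, norm_mul]
    refine mul_le_mul_of_nonneg_left ?_ (norm_nonneg _)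
    rw [norm_pow, norm_pow, norm_mul, norm_pow]
    exact pow_le_pow_left₀ (by positivity) (mul_le_of_le_one_right (norm_nonneg _)
      (pow_le_one₀ (norm_nonneg _) hp.le)) _

lemma choose_succ_two (n : ℕ) : (n + 1).choose 2 = n + n.choose 2 := by
  rw [Nat.choose_succ_succ' n 1, Nat.choose_one_right]

/-- The weight `n + 1` dominates both `1` and `n`, so one majorant serves the series and its
termwise derivative. -/
lemma summable_gauss (hp : ‖p‖ < 1) (x : ℂ) :
    Summable fun n : ℕ => ((n : ℝ) + 1) * ‖x ^ n * p ^ n.choose 2‖ := by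
  have hlim : Tendsto (fun n : ℕ => 2 * ‖x‖ * ‖p‖ ^ n) atTop (𝓝 0) := by
    simpa using (tendsto_pow_atTop_nhds_zero_of_lt_one (norm_nonneg _) hp).const_mul (2 * ‖x‖)
  refine summable_of_ratio_norm_eventually_le (r := 1 / 2) (by norm_num) ?_
  filter_upwards [hlim.eventually (gt_mem_nhds (show (0 : ℝ) < 1 / 2 by norm_num))] with n hn
  rw [choose_succ_two, pow_succ, pow_add]
  have h1 : ((n + 1 : ℕ) : ℝ) + 1 ≤ 2 * ((n : ℝ) + 1) := by push_cast; linarith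
  have e1 : ‖(((n + 1 : ℕ) : ℝ) + 1) * ‖x ^ n * x * (p ^ n * p ^ n.choose 2)‖‖
      = (((n + 1 : ℕ) : ℝ) + 1) * (‖x‖ * ‖p‖ ^ n * ‖x ^ n * p ^ n.choose 2‖) := by
    rw [Real.norm_of_nonneg (by positivity)]
    simp only [norm_mul, norm_pow]
    ring
  have e2 : ‖((n : ℝ) + 1) * ‖x ^ n * p ^ n.choose 2‖‖
      = ((n : ℝ) + 1) * ‖x ^ n * p ^ n.choose 2‖ := Real.norm_of_nonneg (by positivity)
  rw [e1, e2]
  calc _ ≤ 2 * ((n : ℝ) + 1) * (‖x‖ * ‖p‖ ^ n * ‖x ^ n * p ^ n.choose 2‖) := by gcongr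
    _ = (2 * ‖x‖ * ‖p‖ ^ n) * (((n : ℝ) + 1) * ‖x ^ n * p ^ n.choose 2‖) := by ring
    _ ≤ _ := by gcongr

lemma summable_geom (hx : ‖x‖ < 1) :
    Summable fun n : ℕ => ((n : ℝ) + 1) * ‖x ^ n‖ := by
  have h1 := summable_pow_mul_geometric_of_norm_lt_one 1 (r := ‖x‖) (by simpa using hx)
  have h2 := summable_geometric_of_lt_one (norm_nonneg x) hx
  refine (h1.add h2).congr fun n => ?_
  simp only [norm_pow]; ring

/-- Passing from a weighted majorant to the absolute convergence of the Euler series. -/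
lemma summable_norm_div_qPoch (hp : ‖p‖ < 1) {t : ℕ → ℂ}
    (ht : Summable fun n : ℕ => ((n : ℝ) + 1) * ‖t n‖) :
    (Summable fun n : ℕ => ‖t n / qPoch p p n‖) ∧
      Summable fun n : ℕ => ‖(n : ℂ) * (t n / qPoch p p n)‖ := by
  obtain ⟨C, hC, hb⟩ := exists_norm_inv_qPoch_le hp
  have key (n : ℕ) : ‖t n / qPoch p p n‖ ≤ ‖t n‖ * C := by
    rw [div_eq_mul_inv, norm_mul]
    exact mul_le_mul_of_nonneg_left (hb n) (norm_nonneg _)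
  constructor
  · refine (ht.mul_right C).of_nonneg_of_le (fun _ => norm_nonneg _) fun n => (key n).trans ?_
    gcongr
    nlinarith [norm_nonneg (t n), (Nat.cast_nonneg n : (0 : ℝ) ≤ n)]
  · refine (ht.mul_right C).of_nonneg_of_le (fun _ => norm_nonneg _) fun n => ?_
    rw [norm_mul, Complex.norm_natCast, mul_assoc]
    have := key n
    have h0 : (0 : ℝ) ≤ n := Nat.cast_nonneg n
    have h1 : 0 ≤ ‖t n‖ * C := by positivity
    calc _ ≤ (n : ℝ) * (‖t n‖ * C) := by gcongr
      _ ≤ _ := by gcongr; linarith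

/-- `∑ x^n p^(n(n-1)/2) / (p;p)_n`. -/
noncomputable def gaussEuler (x p : ℂ) : ℂ := ∑' n : ℕ, x ^ n * p ^ n.choose 2 / qPoch p p n

/-- `∑ n x^n p^(n(n-1)/2) / (p;p)_n`. -/
noncomputable def gaussEulerDeriv (x p : ℂ) : ℂ :=
  ∑' n : ℕ, (n : ℂ) * (x ^ n * p ^ n.choose 2 / qPoch p p n)

/-- `∑ x^n / (p;p)_n`. -/
noncomputable def geomEuler (x p : ℂ) : ℂ := ∑' n : ℕ, x ^ n / qPoch p p n

/-- `∑ n x^n / (p;p)_n`. -/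
noncomputable def geomEulerDeriv (x p : ℂ) : ℂ := ∑' n : ℕ, (n : ℂ) * (x ^ n / qPoch p p n)

lemma qPoch_self_succ (p : ℂ) (n : ℕ) : qPoch p p (n + 1) = qPoch p p n * (1 - p ^ (n + 1)) := by
  rw [qPoch_succ, pow_succ']

lemma one_sub_pow_succ_ne_zero (hp : ‖p‖ < 1) (n : ℕ) : 1 - p ^ (n + 1) ≠ 0 := by
  rw [pow_succ']
  exact one_sub_ne_zero_of_norm_lt (norm_mul_pow_lt_one hp hp n)

/-- Subtracting the series at `x * p` puts a factor `1 - p^n` in the `n`-th term; it cancels the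
last factor of `(p;p)_n`, and shifting the index gives the series back. -/
lemma gaussEuler_eq (hp : ‖p‖ < 1) (x : ℂ) :
    gaussEuler x p = (1 + x) * gaussEuler (x * p) p := by
  have s1 := (summable_norm_div_qPoch hp (summable_gauss hp x)).1.of_norm
  have s2 := (summable_norm_div_qPoch hp (summable_gauss hp (x * p))).1.of_norm
  have h : gaussEuler x p - gaussEuler (x * p) p = x * gaussEuler (x * p) p := by
    unfold gaussEuler
    rw [← s1.tsum_sub s2, (s1.sub s2).tsum_eq_zero_add, ← tsum_mul_left]
    simp only [pow_zero, sub_self, zero_add]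
    refine tsum_congr fun n => ?_
    have h1 := qPoch_ne_zero hp hp n
    have h2 := one_sub_pow_succ_ne_zero hp n
    rw [qPoch_self_succ, choose_succ_two]
    field_simp
    ring
  linear_combination h

/-- This is formally `x d/dx` of `gaussEuler_eq`, obtained by the same shift of index. -/
lemma gaussEulerDeriv_eq (hp : ‖p‖ < 1) (x : ℂ) :
    gaussEulerDeriv x p = (1 + x) * gaussEulerDeriv (x * p) p + x * gaussEuler (x * p) p := by
  have s1 := (summable_norm_div_qPoch hp (summable_gauss hp x)).2.of_norm
  have s2 := (summable_norm_div_qPoch hp (summable_gauss hp (x * p))).2.of_norm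
  have s3 := (summable_norm_div_qPoch hp (summable_gauss hp (x * p))).1.of_norm
  have h : gaussEulerDeriv x p - gaussEulerDeriv (x * p) p
      = x * (gaussEulerDeriv (x * p) p + gaussEuler (x * p) p) := by
    unfold gaussEuler gaussEulerDeriv
    rw [← s1.tsum_sub s2, (s1.sub s2).tsum_eq_zero_add, ← s2.tsum_add s3, ← tsum_mul_left]
    simp only [Nat.cast_zero, zero_mul, sub_self, zero_add]
    refine tsum_congr fun n => ?_
    have h1 := qPoch_ne_zero hp hp n
    have h2 := one_sub_pow_succ_ne_zero hp n
    rw [qPoch_self_succ, choose_succ_two]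
    push_cast
    field_simp
    ring
  linear_combination h

lemma norm_mul_lt_one (hp : ‖p‖ < 1) (hx : ‖x‖ < 1) : ‖x * p‖ < 1 := by
  simpa using norm_mul_pow_lt_one hp hx 1

lemma geomEuler_eq (hp : ‖p‖ < 1) (hx : ‖x‖ < 1) :
    geomEuler (x * p) p = (1 - x) * geomEuler x p := by
  have s1 := (summable_norm_div_qPoch hp (summable_geom hx)).1.of_norm
  have s2 := (summable_norm_div_qPoch hp (summable_geom (norm_mul_lt_one hp hx))).1.of_norm
  have h : geomEuler x p - geomEuler (x * p) p = x * geomEuler x p := by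
    unfold geomEuler
    rw [← s1.tsum_sub s2, (s1.sub s2).tsum_eq_zero_add, ← tsum_mul_left]
    simp only [pow_zero, sub_self, zero_add]
    refine tsum_congr fun n => ?_
    have h1 := qPoch_ne_zero hp hp n
    have h2 := one_sub_pow_succ_ne_zero hp n
    rw [qPoch_self_succ]
    field_simp
    ring
  linear_combination -h

lemma geomEulerDeriv_eq (hp : ‖p‖ < 1) (hx : ‖x‖ < 1) :
    geomEulerDeriv (x * p) p = (1 - x) * geomEulerDeriv x p - x * geomEuler x p := by
  have s1 := (summable_norm_div_qPoch hp (summable_geom hx)).2.of_norm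
  have s2 := (summable_norm_div_qPoch hp (summable_geom (norm_mul_lt_one hp hx))).2.of_norm
  have s3 := (summable_norm_div_qPoch hp (summable_geom hx)).1.of_norm
  have h : geomEulerDeriv x p - geomEulerDeriv (x * p) p
      = x * (geomEulerDeriv x p + geomEuler x p) := by
    unfold geomEuler geomEulerDeriv
    rw [← s1.tsum_sub s2, (s1.sub s2).tsum_eq_zero_add, ← s1.tsum_add s3, ← tsum_mul_left]
    simp only [Nat.cast_zero, zero_mul, sub_self, zero_add]
    refine tsum_congr fun n => ?_
    have h1 := qPoch_ne_zero hp hp n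
    have h2 := one_sub_pow_succ_ne_zero hp n
    rw [qPoch_self_succ]
    push_cast
    field_simp
    ring
  linear_combination -h

lemma tendsto_gaussEuler (hp : ‖p‖ < 1) (x : ℂ) :
    Tendsto (fun k : ℕ => gaussEuler (x * p ^ k) p) atTop (𝓝 1) := by
  have h := tendsto_tsum_mul_pow_atTop (x := x) hp (c := fun n => p ^ n.choose 2 / qPoch p p n)
    ((summable_norm_div_qPoch hp (summable_gauss hp x)).1.congr fun n => by congr 1; ring)
  simp only [Nat.choose_zero_succ, pow_zero, qPoch_zero, div_one] at h
  refine h.congr fun k => tsum_congr fun n => by ring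

lemma tendsto_gaussEulerDeriv (hp : ‖p‖ < 1) (x : ℂ) :
    Tendsto (fun k : ℕ => gaussEulerDeriv (x * p ^ k) p) atTop (𝓝 0) := by
  have h := tendsto_tsum_mul_pow_atTop (x := x) hp
    (c := fun n => (n : ℂ) * (p ^ n.choose 2 / qPoch p p n))
    ((summable_norm_div_qPoch hp (summable_gauss hp x)).2.congr fun n => by congr 1; ring)
  simp only [Nat.cast_zero, zero_mul] at h
  refine h.congr fun k => tsum_congr fun n => by ring

lemma tendsto_geomEuler (hp : ‖p‖ < 1) (hx : ‖x‖ < 1) :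
    Tendsto (fun k : ℕ => geomEuler (x * p ^ k) p) atTop (𝓝 1) := by
  have h := tendsto_tsum_mul_pow_atTop (x := x) hp (c := fun n => 1 / qPoch p p n)
    ((summable_norm_div_qPoch hp (summable_geom hx)).1.congr fun n => by congr 1; ring)
  simp only [qPoch_zero, div_one] at h
  refine h.congr fun k => tsum_congr fun n => by ring

lemma tendsto_geomEulerDeriv (hp : ‖p‖ < 1) (hx : ‖x‖ < 1) :
    Tendsto (fun k : ℕ => geomEulerDeriv (x * p ^ k) p) atTop (𝓝 0) := by
  have h := tendsto_tsum_mul_pow_atTop (x := x) hp (c := fun n => (n : ℂ) * (1 / qPoch p p n))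
    ((summable_norm_div_qPoch hp (summable_geom hx)).2.congr fun n => by congr 1; ring)
  simp only [Nat.cast_zero, zero_mul] at h
  refine h.congr fun k => tsum_congr fun n => by ring

/-- Euler: `∑ x^n p^(n(n-1)/2) / (p;p)_n = (-x;p)_∞`. -/
theorem gaussEuler_eq_qPochInf (hp : ‖p‖ < 1) (x : ℂ) : gaussEuler x p = qPochInf (-x) p := by
  -- Iterate the functional equation; as `k → ∞` the remaining series tends to its constant term
  -- `1`.
  have h (k : ℕ) : gaussEuler x p = qPoch (-x) p k * gaussEuler (x * p ^ k) p := by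
    induction k with
    | zero => simp
    | succ k ih =>
      rw [ih, gaussEuler_eq hp (x * p ^ k), qPoch_succ, pow_succ, ← mul_assoc x]
      ring
  have h1 := (tendsto_qPoch hp (-x)).mul (tendsto_gaussEuler hp x)
  rw [mul_one] at h1
  exact tendsto_nhds_unique (tendsto_const_nhds.congr h) h1

/-- Euler: `∑ x^n / (p;p)_n = 1 / (x;p)_∞`. -/
theorem qPochInf_mul_geomEuler (hp : ‖p‖ < 1) (hx : ‖x‖ < 1) :
    qPochInf x p * geomEuler x p = 1 := by
  have h (k : ℕ) : geomEuler (x * p ^ k) p = qPoch x p k * geomEuler x p := by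
    induction k with
    | zero => simp
    | succ k ih =>
      rw [pow_succ, ← mul_assoc, geomEuler_eq hp (norm_mul_pow_lt_one hp hx k), ih, qPoch_succ]
      ring
  exact tendsto_nhds_unique (((tendsto_qPoch hp x).mul_const _).congr fun k => (h k).symm)
    (tendsto_geomEuler hp hx)

/-- The logarithmic derivatives of the two Euler series at `x` and `-x` agree up to sign. -/
theorem gaussEulerDeriv_div (hp : ‖p‖ < 1) (hx : ‖x‖ < 1) :
    gaussEulerDeriv x p / qPochInf (-x) p = -(qPochInf (-x) p * geomEulerDeriv (-x) p) := by
  -- `G` adds the logarithmic derivatives of two mutually reciprocal series. The functional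
  -- equations make it invariant under `y ↦ y * p`, and it tends to `0` along `x * p^k`, so it
  -- vanishes at `x`.
  set G : ℂ → ℂ := fun y =>
    gaussEulerDeriv y p / gaussEuler y p + gaussEuler y p * geomEulerDeriv (-y) p with hG
  have step (y : ℂ) (hy : ‖y‖ < 1) : G y = G (y * p) := by
    have hy' : ‖-y‖ < 1 := by simpa using hy
    have hyp : ‖-(y * p)‖ < 1 := by simpa using norm_mul_lt_one hp hy
    have n1 : 1 + y ≠ 0 := by simpa using one_sub_ne_zero_of_norm_lt hy'
    have n2 : gaussEuler (y * p) p ≠ 0 := by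
      rw [gaussEuler_eq_qPochInf hp]; exact qPochInf_ne_zero hp hyp
    have e1 := gaussEuler_eq hp y
    have e2 := gaussEulerDeriv_eq hp y
    have e3 := geomEulerDeriv_eq hp hy'
    have e4 := qPochInf_mul_geomEuler hp hy'
    rw [← gaussEuler_eq_qPochInf hp, e1] at e4
    rw [neg_mul] at e3
    simp only [hG]
    rw [e3, e1, e2]
    field_simp
    linear_combination -gaussEuler (y * p) p * y * e4
  have hk (k : ℕ) : G x = G (x * p ^ k) := by
    induction k with
    | zero => simp
    | succ k ih => rw [ih, step _ (norm_mul_pow_lt_one hp hx k), pow_succ, mul_assoc]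
  have lim : Tendsto (fun k : ℕ => G (x * p ^ k)) atTop (𝓝 (0 / 1 + 1 * 0)) := by
    refine ((tendsto_gaussEulerDeriv hp x).div (tendsto_gaussEuler hp x) one_ne_zero).add
      ((tendsto_gaussEuler hp x).mul ?_)
    simpa only [neg_mul] using tendsto_geomEulerDeriv (x := -x) hp (by simpa using hx)
  have h0 : G x = 0 := by
    simpa using tendsto_nhds_unique (tendsto_const_nhds.congr hk) lim
  rw [← gaussEuler_eq_qPochInf hp]
  exact eq_neg_of_add_eq_zero_left h0

end EulerSeries

/-! ### The Jacobi triple product and its derivative -/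

section TripleProduct

variable {p z : ℂ}

/-- The bound is uniform in `k`, as dominated convergence for `k → ∞` requires. -/
lemma norm_cauchy_term_le (hp : ‖p‖ < 1) {C : ℝ} (hC : 0 ≤ C)
    (hb : ∀ n, ‖(qPoch p p n)⁻¹‖ ≤ C) (k m : ℕ) :
    ‖p ^ (m * (m + k)) / (qPoch p p m * qPoch p p (m + k))‖ ≤ ‖p‖ ^ m * (C * C) := by
  rw [div_eq_mul_inv, mul_inv, norm_mul, norm_mul, norm_pow]
  have h1 : ‖p‖ ^ (m * (m + k)) ≤ ‖p‖ ^ m := by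
    refine pow_le_pow_of_le_one (norm_nonneg _) hp.le ?_
    nlinarith [Nat.le_mul_self m, Nat.zero_le (m * k)]
  have h2 := hb m
  have h3 := hb (m + k)
  gcongr

lemma summable_cauchy_bound (hp : ‖p‖ < 1) (C : ℝ) : Summable fun m : ℕ => ‖p‖ ^ m * C :=
  (summable_geometric_of_lt_one (norm_nonneg _) hp).mul_right C

/-- Cauchy's identity `∑ p^(m(m+k)) / ((p;p)_m (p;p)_(m+k)) = 1 / (p;p)_∞`. -/
theorem tsum_cauchy (hp : ‖p‖ < 1) (k : ℕ) :
    ∑' m : ℕ, p ^ (m * (m + k)) / (qPoch p p m * qPoch p p (m + k)) = (qPochInf p p)⁻¹ := by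
  obtain ⟨C, hC, hb⟩ := exists_norm_inv_qPoch_le hp
  set t : ℕ → ℕ → ℂ := fun k m => p ^ (m * (m + k)) / (qPoch p p m * qPoch p p (m + k)) with ht
  have st (k : ℕ) : Summable (t k) :=
    .of_norm_bounded (summable_cauchy_bound hp (C * C)) (norm_cauchy_term_le hp hC hb k)
  have step (k : ℕ) : ∑' m, t k m = ∑' m, t (k + 1) m := by
    -- Telescoping certificate: `t k m - t (k + 1) m = g m - g (m + 1)`, and `g 0 = 0`. Hence the
    -- sum does not depend on `k`.
    set g : ℕ → ℂ := fun m => (1 - p ^ m) * t k m with hg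
    have sg : Summable g := by
      refine .of_norm_bounded ((summable_cauchy_bound hp (C * C)).mul_left 2) fun m => ?_
      rw [hg, norm_mul]
      have h1 : ‖1 - p ^ m‖ ≤ 2 := by
        refine (norm_sub_le _ _).trans ?_
        rw [norm_one, norm_pow]
        linarith [pow_le_one₀ (n := m) (norm_nonneg p) hp.le]
      have h2 := norm_cauchy_term_le hp hC hb k m
      exact mul_le_mul h1 h2 (norm_nonneg _) (by norm_num)
    have sg' : Summable fun m => g (m + 1) := (summable_nat_add_iff 1).2 sg
    have hs : ∑' m, g m = ∑' m, g (m + 1) := by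
      rw [sg.tsum_eq_zero_add]; simp [hg]
    rw [← sub_eq_zero, ← (st k).tsum_sub (st (k + 1)), ← sub_eq_zero.2 hs, ← sg.tsum_sub sg']
    refine tsum_congr fun m => ?_
    have h1 := qPoch_ne_zero hp hp m
    have h2 := qPoch_ne_zero hp hp (m + k)
    have h3 := one_sub_pow_succ_ne_zero hp m
    have h4 := one_sub_pow_succ_ne_zero hp (m + k)
    simp only [hg, ht]
    rw [show m + 1 + k = m + k + 1 by ring, show m + (k + 1) = m + k + 1 by ring,
      qPoch_self_succ, qPoch_self_succ]
    field_simp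
    ring
  have hconst (j : ℕ) : ∑' m, t k m = ∑' m, t (k + j) m := by
    induction j with
    | zero => rfl
    | succ j ih => rw [ih, step, add_assoc]
  -- In the limit only the term `m = 0`, which is `1 / (p;p)_(k+j)`, survives.
  have lim : Tendsto (fun j => ∑' m, t (k + j) m) atTop
      (𝓝 (∑' m, if m = 0 then (qPochInf p p)⁻¹ else 0)) := by
    refine tendsto_tsum_of_dominated_convergence (summable_cauchy_bound hp (C * C)) (fun m => ?_)
      (.of_forall fun j m => norm_cauchy_term_le hp hC hb (k + j) m)
    rcases eq_or_ne m 0 with rfl | hm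
    · simp only [ht, zero_mul, pow_zero, qPoch_zero, one_mul, zero_add, if_true, one_div]
      simpa only [add_comm] using (tendsto_add_atTop_iff_nat k).2 (tendsto_inv_qPoch hp)
    · rw [if_neg hm]
      have hz : Tendsto (fun j : ℕ => ‖p‖ ^ j * (C * C)) atTop (𝓝 0) := by
        simpa using (tendsto_pow_atTop_nhds_zero_of_lt_one (norm_nonneg _) hp).mul_const (C * C)
      refine squeeze_zero_norm (fun j => ?_) hz
      simp only [ht]
      rw [div_eq_mul_inv, mul_inv, norm_mul, norm_mul, norm_pow]
      have h1 : ‖p‖ ^ (m * (m + (k + j))) ≤ ‖p‖ ^ j := by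
        refine pow_le_pow_of_le_one (norm_nonneg _) hp.le ?_
        have : 1 ≤ m := Nat.one_le_iff_ne_zero.2 hm
        nlinarith [Nat.zero_le (m + k)]
      have h2 := hb m
      have h3 := hb (m + (k + j))
      gcongr
  rw [tsum_ite_eq] at lim
  exact tendsto_nhds_unique (tendsto_const_nhds.congr hconst) lim

/-- The integer `n(n-1)/2`. -/
def tri (n : ℤ) : ℤ := n * (n - 1) / 2

lemma two_mul_tri (n : ℤ) : 2 * tri n = n * (n - 1) :=
  Int.mul_ediv_cancel' (by simpa [mul_comm] using (Int.even_mul_pred_self n).two_dvd)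

lemma tri_natCast (n : ℕ) : tri n = (n.choose 2 : ℕ) := by
  have h := two_mul_tri n
  have h2 : ((n.choose 2 : ℕ) : ℤ) * 2 = n * (n - 1) := by
    induction n with
    | zero => simp
    | succ n ih =>
      have := ih (two_mul_tri n)
      rw [choose_succ_two]; push_cast; linarith
  linarith

/-- The bijection `(n, m) ↦ (n⁺ + m, n⁻ + m)`. -/
def intProdNatEquiv : ℤ × ℕ ≃ ℕ × ℕ where
  toFun x := (x.1.toNat + x.2, (-x.1).toNat + x.2)
  invFun y := ((y.1 : ℤ) - y.2, min y.1 y.2)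
  left_inv := by rintro ⟨n, m⟩; simp only [Prod.mk.injEq]; omega
  right_inv := by rintro ⟨a, b⟩; simp only [Prod.mk.injEq]; omega

lemma gauss_term_mul (hp0 : p ≠ 0) (hz : z ≠ 0) (n : ℤ) (m : ℕ) :
    z ^ (n.toNat + m) * p ^ (n.toNat + m).choose 2 *
        ((p / z) ^ ((-n).toNat + m) * p ^ ((-n).toNat + m).choose 2) =
      z ^ n * p ^ tri n * p ^ (m * (m + n.natAbs)) := by
  obtain ⟨a, ha⟩ : ∃ a : ℕ, a = n.toNat + m := ⟨_, rfl⟩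
  obtain ⟨b, hb⟩ : ∃ b : ℕ, b = (-n).toNat + m := ⟨_, rfl⟩
  rw [← ha, ← hb]
  have hn : n = (a : ℤ) - b := by omega
  have e : tri a + b + tri b = tri n + m * (m + n.natAbs) := by
    have h1 := two_mul_tri a
    have h2 := two_mul_tri b
    have h3 := two_mul_tri n
    rcases le_total 0 n with h | h
    · have hb' : (b : ℤ) = m := by omega
      have ha' : (a : ℤ) = n + m := by omega
      have : (n.natAbs : ℤ) = n := by omega
      rw [this]; rw [ha'] at h1 ⊢; rw [hb'] at h2 ⊢; linarith
    · have hb' : (b : ℤ) = -n + m := by omega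
      have ha' : (a : ℤ) = m := by omega
      have : (n.natAbs : ℤ) = -n := by omega
      rw [this]; rw [ha'] at h1 ⊢; rw [hb'] at h2 ⊢; linarith
  have hpp : p ^ a.choose 2 * p ^ b * p ^ b.choose 2 = p ^ tri n * p ^ (m * (m + n.natAbs)) := by
    rw [← zpow_natCast p, ← zpow_natCast p b, ← zpow_natCast p (b.choose 2),
      ← zpow_natCast p (m * _), ← tri_natCast, ← tri_natCast, ← zpow_add₀ hp0, ← zpow_add₀ hp0,
      ← zpow_add₀ hp0, e]
    push_cast; rfl
  rw [mul_assoc (z ^ n), ← hpp, hn, zpow_sub₀ hz, zpow_natCast, zpow_natCast, div_pow]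
  ring

/-- Collect a product of two Euler series by the difference `n` of the indices: the inner sum is
Cauchy's and does not depend on `n`. The weight `w` is `1` for the triple product and `n` for its
derivative. -/
lemma triple_regroup (hp : ‖p‖ < 1) (hp0 : p ≠ 0) (hz : z ≠ 0) (w : ℤ → ℂ)
    (hs : Summable fun y : ℕ × ℕ => w ((y.1 : ℤ) - y.2) *
      (z ^ y.1 * p ^ y.1.choose 2 / qPoch p p y.1 *
        ((p / z) ^ y.2 * p ^ y.2.choose 2 / qPoch p p y.2))) :
    ∑' y : ℕ × ℕ, w ((y.1 : ℤ) - y.2) *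
      (z ^ y.1 * p ^ y.1.choose 2 / qPoch p p y.1 *
        ((p / z) ^ y.2 * p ^ y.2.choose 2 / qPoch p p y.2)) =
      (qPochInf p p)⁻¹ * ∑' n : ℤ, w n * (z ^ n * p ^ tri n) := by
  rw [← intProdNatEquiv.tsum_eq]
  have hs' := (intProdNatEquiv.summable_iff).2 hs
  rw [Summable.tsum_prod (by exact hs'), ← tsum_mul_left]
  refine tsum_congr fun n => ?_
  rw [← tsum_cauchy hp n.natAbs, ← tsum_mul_right]
  refine tsum_congr fun m => ?_
  have h1 : ((n.toNat + m : ℕ) : ℤ) - ((-n).toNat + m : ℕ) = n := by omega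
  have h2 : qPoch p p (n.toNat + m) * qPoch p p ((-n).toNat + m)
      = qPoch p p m * qPoch p p (m + n.natAbs) := by
    rcases le_total 0 n with h | h
    · rw [show n.toNat + m = m + n.natAbs by omega, show (-n).toNat + m = m by omega, mul_comm]
    · rw [show n.toNat + m = m by omega, show (-n).toNat + m = m + n.natAbs by omega]
  simp only [intProdNatEquiv, Equiv.coe_fn_mk]
  rw [h1, div_mul_div_comm, gauss_term_mul hp0 hz, h2]
  ring

/-- The Jacobi triple product identity. -/
theorem tsum_triple (hp : ‖p‖ < 1) (hp0 : p ≠ 0) (hz : z ≠ 0) :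
    ∑' n : ℤ, z ^ n * p ^ tri n =
      qPochInf p p * (qPochInf (-z) p * qPochInf (-(p / z)) p) := by
  have s1 := (summable_norm_div_qPoch hp (summable_gauss hp z)).1
  have s2 := (summable_norm_div_qPoch hp (summable_gauss hp (p / z))).1
  have h := triple_regroup hp hp0 hz (fun _ => 1)
    (by simpa only [one_mul] using summable_mul_of_summable_norm s1 s2)
  simp only [one_mul] at h
  rw [← tsum_mul_tsum_of_summable_norm s1 s2] at h
  rw [← gaussEuler_eq_qPochInf hp, ← gaussEuler_eq_qPochInf hp, gaussEuler, gaussEuler, h,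
    mul_inv_cancel_left₀ (qPochInf_ne_zero hp hp)]

/-- The derivative of the Jacobi triple product identity. -/
theorem tsum_mul_triple (hp : ‖p‖ < 1) (hp0 : p ≠ 0) (hz : z ≠ 0) :
    ∑' n : ℤ, (n : ℂ) * (z ^ n * p ^ tri n) =
      qPochInf p p * (gaussEulerDeriv z p * qPochInf (-(p / z)) p -
        qPochInf (-z) p * gaussEulerDeriv (p / z) p) := by
  have s1 := (summable_norm_div_qPoch hp (summable_gauss hp z))
  have s2 := (summable_norm_div_qPoch hp (summable_gauss hp (p / z)))
  have t1 := summable_mul_of_summable_norm s1.2 s2.1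
  have t2 := summable_mul_of_summable_norm s1.1 s2.2
  have e (y : ℕ × ℕ) : (((y.1 : ℤ) - y.2 : ℤ) : ℂ) *
      (z ^ y.1 * p ^ y.1.choose 2 / qPoch p p y.1 *
        ((p / z) ^ y.2 * p ^ y.2.choose 2 / qPoch p p y.2)) =
      (y.1 : ℂ) * (z ^ y.1 * p ^ y.1.choose 2 / qPoch p p y.1) *
        ((p / z) ^ y.2 * p ^ y.2.choose 2 / qPoch p p y.2) -
      z ^ y.1 * p ^ y.1.choose 2 / qPoch p p y.1 *
        ((y.2 : ℂ) * ((p / z) ^ y.2 * p ^ y.2.choose 2 / qPoch p p y.2)) := by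
    push_cast; ring
  have h := triple_regroup hp hp0 hz (fun n => (n : ℂ)) ((t1.sub t2).congr fun y => (e y).symm)
  rw [tsum_congr e, t1.tsum_sub t2, ← tsum_mul_tsum_of_summable_norm s1.2 s2.1,
    ← tsum_mul_tsum_of_summable_norm s1.1 s2.2] at h
  rw [← gaussEuler_eq_qPochInf hp, ← gaussEuler_eq_qPochInf hp]
  simp only [gaussEuler, gaussEulerDeriv]
  rw [h, mul_inv_cancel_left₀ (qPochInf_ne_zero hp hp)]

/-- Absolute convergence of the theta series and of its derivative. -/
lemma summable_norm_triple (hp : ‖p‖ < 1) (hp0 : p ≠ 0) (z : ℂ) :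
    (Summable fun n : ℤ => ‖z ^ n * p ^ tri n‖) ∧
      Summable fun n : ℤ => ‖(n : ℂ) * (z ^ n * p ^ tri n)‖ := by
  have epos (n : ℕ) : z ^ (n : ℤ) * p ^ tri n = z ^ n * p ^ n.choose 2 := by
    rw [tri_natCast, zpow_natCast, zpow_natCast]
  have eneg (n : ℕ) : z ^ (-(n : ℤ)) * p ^ tri (-(n : ℤ)) = (p / z) ^ n * p ^ n.choose 2 := by
    have : tri (-(n : ℤ)) = n + (n.choose 2 : ℕ) := by
      have h1 := two_mul_tri (-(n : ℤ))
      have h2 := two_mul_tri n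
      rw [← tri_natCast]; linarith
    rw [this, zpow_add₀ hp0, zpow_natCast, zpow_natCast, zpow_neg, zpow_natCast, div_pow]
    ring
  have b1 (x : ℂ) : Summable fun n : ℕ => ‖x ^ n * p ^ n.choose 2‖ :=
    (summable_gauss hp x).of_nonneg_of_le (fun _ => norm_nonneg _) fun n =>
      le_mul_of_one_le_left (norm_nonneg _) (by linarith [(Nat.cast_nonneg n : (0 : ℝ) ≤ n)])
  have b2 (x : ℂ) : Summable fun n : ℕ => (n : ℝ) * ‖x ^ n * p ^ n.choose 2‖ :=
    (summable_gauss hp x).of_nonneg_of_le (fun _ => by positivity) fun n => by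
      gcongr; linarith
  constructor
  · exact .of_nat_of_neg (by simpa only [epos] using b1 z) (by simpa only [eneg] using b1 (p / z))
  · refine .of_nat_of_neg ?_ ?_
    · simpa only [epos, norm_mul, Int.cast_natCast, Complex.norm_natCast] using! b2 z
    · simpa only [eneg, norm_mul, Int.cast_neg, norm_neg, Int.cast_natCast, Complex.norm_natCast]
        using! b2 (p / z)

end TripleProduct

/-! ### Dissections of infinite products -/

section Products

variable {p x : ℂ}

lemma norm_pow_lt_one {q : ℂ} (hq : ‖q‖ < 1) {k : ℕ} (hk : k ≠ 0) : ‖q ^ k‖ < 1 := by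
  rw [norm_pow]; exact pow_lt_one₀ (norm_nonneg _) hq hk

lemma tendsto_qPoch_mul (hp : ‖p‖ < 1) (x : ℂ) {k : ℕ} (hk : 0 < k) :
    Tendsto (fun n => qPoch x p (k * n)) atTop (𝓝 (qPochInf x p)) :=
  (tendsto_qPoch hp x).comp (tendsto_id.const_mul_atTop' hk)

lemma qPochInf_split_two (hp : ‖p‖ < 1) (x : ℂ) :
    qPochInf x p = qPochInf x (p ^ 2) * qPochInf (x * p) (p ^ 2) := by
  have hp2 := norm_pow_lt_one hp two_ne_zero
  refine tendsto_nhds_unique ((tendsto_qPoch_mul hp x two_pos).congr fun n => ?_)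
    ((tendsto_qPoch hp2 x).mul (tendsto_qPoch hp2 (x * p)))
  induction n with
  | zero => simp
  | succ n ih =>
    have e : qPoch x p (2 * (n + 1)) =
        qPoch x p (2 * n) * (1 - x * p ^ (2 * n)) * (1 - x * p ^ (2 * n + 1)) := by
      rw [← qPoch_succ, ← qPoch_succ]; rfl
    rw [e, ih, qPoch_succ, qPoch_succ]; ring

lemma qPochInf_split_three (hp : ‖p‖ < 1) (x : ℂ) :
    qPochInf x p =
      qPochInf x (p ^ 3) * qPochInf (x * p) (p ^ 3) * qPochInf (x * p ^ 2) (p ^ 3) := by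
  have hp3 := norm_pow_lt_one hp three_ne_zero
  refine tendsto_nhds_unique ((tendsto_qPoch_mul hp x three_pos).congr fun n => ?_)
    (((tendsto_qPoch hp3 x).mul (tendsto_qPoch hp3 (x * p))).mul (tendsto_qPoch hp3 (x * p ^ 2)))
  induction n with
  | zero => simp
  | succ n ih =>
    have e : qPoch x p (3 * (n + 1)) = qPoch x p (3 * n) * (1 - x * p ^ (3 * n)) *
        (1 - x * p ^ (3 * n + 1)) * (1 - x * p ^ (3 * n + 2)) := by
      rw [← qPoch_succ, ← qPoch_succ, ← qPoch_succ]; rfl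
    rw [e, ih, qPoch_succ, qPoch_succ, qPoch_succ]
    ring

lemma qPochInf_neg_mul (hp : ‖p‖ < 1) (x : ℂ) :
    qPochInf (-x) p * qPochInf x p = qPochInf (x ^ 2) (p ^ 2) := by
  refine tendsto_nhds_unique (((tendsto_qPoch hp (-x)).mul (tendsto_qPoch hp x)).congr fun n => ?_)
    (tendsto_qPoch (norm_pow_lt_one hp two_ne_zero) (x ^ 2))
  induction n with
  | zero => simp
  | succ n ih => rw [qPoch_succ, qPoch_succ, qPoch_succ, ← ih]; ring

/-- Euler: `(-q;q)_∞ (q;q^2)_∞ = 1`. -/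
lemma qPochInf_neg_self_mul {q : ℂ} (hq : ‖q‖ < 1) :
    qPochInf (-q) q * qPochInf q (q ^ 2) = 1 := by
  have h1 := qPochInf_neg_mul hq q
  have h2 := qPochInf_split_two hq q
  rw [← pow_two] at h2
  have h3 : qPochInf (q ^ 2) (q ^ 2) ≠ 0 :=
    qPochInf_ne_zero (norm_pow_lt_one hq two_ne_zero) (norm_pow_lt_one hq two_ne_zero)
  rw [h2] at h1
  exact mul_right_cancel₀ h3 (by linear_combination h1)

/-- The factor `1 + x` of the functional equation vanishes at `x = -1`. -/
lemma qPochInf_one (hp : ‖p‖ < 1) : qPochInf 1 p = 0 := by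
  have h := gaussEuler_eq hp (-1)
  rw [gaussEuler_eq_qPochInf hp, neg_neg] at h
  rw [h]; ring

end Products

/-! ### Theta series and the weighted double sum -/

section Theta

variable {q : ℂ}

lemma phi_term (hq0 : q ≠ 0) (n : ℤ) : (-q) ^ (n ^ 2) = (-q) ^ n * (q ^ 2) ^ tri n := by
  have h : n ^ 2 = n + 2 * tri n := by rw [two_mul_tri]; ring
  rw [h, zpow_add₀ (neg_ne_zero.2 hq0), zpow_mul, zpow_ofNat, neg_sq]

lemma summable_phi (hq : ‖q‖ < 1) : Summable fun n : ℤ => (-q) ^ (n ^ 2) := by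
  rcases eq_or_ne q 0 with rfl | hq0
  · refine (hasSum_single (0 : ℤ) fun n hn => ?_).summable
    rw [neg_zero, zero_zpow _ (pow_ne_zero 2 hn)]
  · simp_rw [phi_term hq0]
    exact (summable_norm_triple (norm_pow_lt_one hq two_ne_zero) (pow_ne_zero 2 hq0) _).1.of_norm

/-- `φ(-q) = (q^2;q^2)_∞ (q;q^2)_∞^2`. -/
lemma ramanujanPhi_neg (hq : ‖q‖ < 1) (hq0 : q ≠ 0) :
    ramanujanPhi (-q) = qPochInf (q ^ 2) (q ^ 2) * qPochInf q (q ^ 2) ^ 2 := by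
  have h := tsum_triple (norm_pow_lt_one hq two_ne_zero) (pow_ne_zero 2 hq0) (neg_ne_zero.2 hq0)
  have e : -(q ^ 2 / -q) = q := by field_simp
  rw [neg_neg, e] at h
  rw [ramanujanPhi, tsum_congr (phi_term hq0), h, pow_two (qPochInf q _)]

lemma ramanujanPhi_zero : ramanujanPhi 0 = 1 := by
  rw [ramanujanPhi, tsum_eq_single 0 fun n hn => zero_zpow _ (pow_ne_zero 2 hn)]
  simp

lemma ramanujanPhi_neg_ne_zero (hq : ‖q‖ < 1) : ramanujanPhi (-q) ≠ 0 := by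
  rcases eq_or_ne q 0 with rfl | hq0
  · rw [neg_zero, ramanujanPhi_zero]; exact one_ne_zero
  · have h2 := norm_pow_lt_one hq two_ne_zero
    rw [ramanujanPhi_neg hq hq0]
    exact mul_ne_zero (qPochInf_ne_zero h2 h2) (pow_ne_zero 2 (qPochInf_ne_zero h2 hq))

lemma tsum_alternating_tri (hq : ‖q‖ < 1) (hq0 : q ≠ 0) :
    ∑' n : ℤ, (-1 : ℂ) ^ n * q ^ tri n = 0 := by
  rw [tsum_triple hq hq0 (by norm_num), neg_neg, qPochInf_one hq]; ring

/-- Jacobi: `∑ (-1)^n n q^(n(n-1)/2) = -(q;q)_∞^3`. -/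
lemma tsum_mul_alternating_tri (hq : ‖q‖ < 1) (hq0 : q ≠ 0) :
    ∑' n : ℤ, (n : ℂ) * ((-1 : ℂ) ^ n * q ^ tri n) = -qPochInf q q ^ 3 := by
  -- At `x = -1` the factor `1 + x` kills the derivative on the right, leaving `-(q;q)_∞`; the other
  -- term of the triple product derivative contains `(1;q)_∞ = 0`.
  have h := gaussEulerDeriv_eq hq (-1)
  rw [gaussEuler_eq_qPochInf hq] at h
  rw [tsum_mul_triple hq hq0 (by norm_num), h, neg_neg, qPochInf_one hq, div_neg, div_one, neg_neg,
    neg_mul, one_mul, neg_neg]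
  ring

/-- The bijection `(r, j, n) ↦ (j + r - 2 n, n + j)`. -/
def finProdIntEquiv : Fin 3 × (ℤ × ℤ) ≃ ℤ × ℤ where
  toFun y := (y.2.1 + (y.1 : ℕ) - 2 * y.2.2, y.2.2 + y.2.1)
  invFun x := (⟨((x.1 + 2 * x.2) % 3).toNat, by omega⟩, ((x.1 + 2 * x.2) / 3,
    x.2 - (x.1 + 2 * x.2) / 3))
  left_inv := by
    rintro ⟨⟨r, hr⟩, j, n⟩
    simp only [Prod.mk.injEq, Fin.mk.injEq]
    omega
  right_inv := by
    rintro ⟨a, b⟩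
    simp only [Prod.mk.injEq]
    omega

lemma neg_pow_zpow_mul (hq0 : q ≠ 0) (k l : ℕ) (n t : ℤ) :
    (-q ^ k) ^ n * (q ^ l) ^ t = (-1) ^ n * q ^ (k * n + l * t) := by
  rw [neg_eq_neg_one_mul, mul_zpow, zpow_add₀ hq0, zpow_mul, zpow_mul, zpow_natCast, zpow_natCast]
  ring

lemma pow_zpow_mul (hq0 : q ≠ 0) (k l : ℕ) (n t : ℤ) :
    (q ^ k) ^ n * (q ^ l) ^ t = q ^ (k * n + l * t) := by
  rw [zpow_add₀ hq0, zpow_mul, zpow_mul, zpow_natCast, zpow_natCast]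

lemma theta_product_term (hq0 : q ≠ 0) (a b : ℤ) :
    (-1 : ℂ) ^ a * q ^ tri a * ((-q) ^ b * (q ^ 2) ^ tri b) =
      (-1) ^ (a + b) * q ^ (tri a + b + 2 * tri b) := by
  have h := neg_pow_zpow_mul hq0 1 2 b (tri b)
  rw [pow_one] at h
  rw [h, zpow_add₀ (by norm_num : (-1 : ℂ) ≠ 0), add_assoc, zpow_add₀ hq0 (tri a)]
  push_cast
  rw [one_mul]
  ring

lemma neg_one_zpow_two_mul_sub (j n : ℤ) : (-1 : ℂ) ^ (2 * j - n) = (-1) ^ n := by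
  rw [zpow_sub₀ (by norm_num), zpow_mul]
  rcases Int.even_or_odd n with h | h
  · simp [h.neg_one_zpow]
  · simp [h.neg_one_zpow]

/-- The limiting case of the quintuple product identity: `(q;q)_∞^3 φ(-q)` as the product of
`∑ (-1)^n q^(3n^2+n) = (q^2;q^2)_∞` and `∑ (1 - 6 n) q^(n(3n-1)/2)`. -/
theorem qPochInf_cube_mul_ramanujanPhi (hq : ‖q‖ < 1) (hq0 : q ≠ 0) :
    qPochInf q q ^ 3 * ramanujanPhi (-q) = qPochInf (q ^ 2) (q ^ 2) *
      (∑' n : ℤ, q ^ n * (q ^ 3) ^ tri n - 6 * ∑' n : ℤ, (n : ℂ) * (q ^ n * (q ^ 3) ^ tri n)) := by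
  have hq2 := norm_pow_lt_one hq (k := 2) (by norm_num)
  have hq3 := norm_pow_lt_one hq (k := 3) (by norm_num)
  have hq6 := norm_pow_lt_one hq (k := 6) (by norm_num)
  have h2 := pow_ne_zero 2 hq0
  have h3 := pow_ne_zero 3 hq0
  have h4 := pow_ne_zero 4 hq0
  have h6 := pow_ne_zero 6 hq0
  have sA := summable_norm_triple hq hq0 (-1)
  have sB := summable_norm_triple hq2 h2 (-q)
  have sP (z : ℂ) := summable_norm_triple hq6 h6 z
  have sT (z : ℂ) := summable_norm_triple hq3 h3 z
  set A : ℤ → ℂ := fun m => (-1) ^ m * q ^ tri m with hA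
  set B : ℤ → ℂ := fun n => (-q) ^ n * (q ^ 2) ^ tri n with hB
  set P : ℂ → ℤ → ℂ := fun z n => z ^ n * (q ^ 6) ^ tri n with hP
  set T : ℂ → ℤ → ℂ := fun z n => z ^ n * (q ^ 3) ^ tri n with hT
  have hBsum : ∑' n, B n = ramanujanPhi (-q) := (tsum_congr (phi_term hq0)).symm
  -- The inner theta series for the residues 0 and 1 are both this product; the one for residue 2 is
  -- `P0`, which vanishes.
  have pent : qPochInf (q ^ 6) (q ^ 6) * (qPochInf (q ^ 4) (q ^ 6) * qPochInf (q ^ 2) (q ^ 6))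
      = qPochInf (q ^ 2) (q ^ 2) := by
    have := qPochInf_split_three hq2 (q ^ 2)
    rw [← pow_add, ← pow_mul, ← pow_mul, ← pow_add] at this
    rw [this]; ring
  have P4 : ∑' n, P (-q ^ 4) n = qPochInf (q ^ 2) (q ^ 2) := by
    have e : -(q ^ 6 / -q ^ 4) = q ^ 2 := by field_simp
    rw [hP, tsum_triple hq6 h6 (neg_ne_zero.2 h4), neg_neg, e, pent]
  have P2 : ∑' n, P (-q ^ 2) n = qPochInf (q ^ 2) (q ^ 2) := by
    have e : -(q ^ 6 / -q ^ 2) = q ^ 4 := by field_simp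
    rw [hP, tsum_triple hq6 h6 (neg_ne_zero.2 h2), neg_neg, e, ← pent]; ring
  have P0 : ∑' n, P (-1) n = 0 := tsum_alternating_tri hq6 h6
  have t1 := summable_mul_of_summable_norm sA.2 sB.1
  have t2 := summable_mul_of_summable_norm sA.1 sB.2
  have sF : Summable fun x : ℤ × ℤ => ((x.1 + 2 * x.2 : ℤ) : ℂ) * (A x.1 * B x.2) :=
    (t1.add (t2.mul_left 2)).congr fun x => by push_cast; ring
  -- Since `∑ A = 0`, the part of the weight coming from the second index contributes nothing.
  have hF : ∑' x : ℤ × ℤ, ((x.1 + 2 * x.2 : ℤ) : ℂ) * (A x.1 * B x.2) =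
      -(qPochInf q q ^ 3 * ramanujanPhi (-q)) := by
    have : ∑' x : ℤ × ℤ, ((x.1 + 2 * x.2 : ℤ) : ℂ) * (A x.1 * B x.2) =
        ∑' x : ℤ × ℤ, ((x.1 : ℂ) * A x.1 * B x.2 + 2 * (A x.1 * ((x.2 : ℂ) * B x.2))) :=
      tsum_congr fun x => by push_cast; ring
    rw [this, t1.tsum_add (t2.mul_left 2), tsum_mul_left,
      ← tsum_mul_tsum_of_summable_norm sA.2 sB.1, ← tsum_mul_tsum_of_summable_norm sA.1 sB.2,
      hBsum, tsum_alternating_tri hq hq0, tsum_mul_alternating_tri hq hq0]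
    ring
  -- In these coordinates the exponent has no `j * n` term and the weight is `3 * j + r`,
  -- independent of `n`; so each residue `r` gives a weighted sum over `j` times a plain theta
  -- series in `n`.
  have term (r : ℕ) (j n : ℤ) : A (j + r - 2 * n) * B (n + j) =
      (-1) ^ (2 * j + r - n) *
        q ^ (tri (j + r - 2 * n) + (n + j) + 2 * tri (n + j)) := by
    rw [hA, hB, theta_product_term hq0]
    congr 2; ring
  have term0 (j n : ℤ) : A (j - 2 * n) * B (n + j) = T q j * P (-q ^ 4) n := by
    have h := term 0 j n
    have e2 := pow_zpow_mul hq0 1 3 j (tri j)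
    simp only [Nat.cast_zero, add_zero, pow_one, Nat.cast_one, one_mul] at h e2
    simp only [hT, hP, h, e2, neg_pow_zpow_mul hq0, neg_one_zpow_two_mul_sub]
    rw [mul_left_comm, ← zpow_add₀ hq0]
    congr 2
    push_cast
    linarith [two_mul_tri (j - 2 * n), two_mul_tri (n + j), two_mul_tri n, two_mul_tri j]
  have term1 (j n : ℤ) : A (j + 1 - 2 * n) * B (n + j) = -(T (q ^ 2) j * P (-q ^ 2) n) := by
    have h := term 1 j n
    simp only [Nat.cast_one] at h
    rw [add_sub_right_comm (2 * j), zpow_add₀ (by norm_num : (-1 : ℂ) ≠ 0),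
      neg_one_zpow_two_mul_sub] at h
    simp only [hT, hP, h, pow_zpow_mul hq0, neg_pow_zpow_mul hq0]
    rw [mul_left_comm (q ^ _), ← zpow_add₀ hq0, zpow_one, mul_neg_one, neg_mul]
    congr 3
    push_cast
    linarith [two_mul_tri (j + 1 - 2 * n), two_mul_tri (n + j), two_mul_tri n, two_mul_tri j]
  have term2 (j n : ℤ) : A (j + 2 - 2 * n) * B (n + j) = q * T (q ^ 3) j * P (-1) n := by
    have h := term 2 j n
    have e2 := neg_pow_zpow_mul hq0 0 6 n (tri n)
    rw [pow_zero, Nat.cast_zero, zero_mul, zero_add] at e2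
    rw [Nat.cast_ofNat, show 2 * j + 2 - n = 2 * (j + 1) - n by ring,
      neg_one_zpow_two_mul_sub] at h
    simp only [hT, hP, h, pow_zpow_mul hq0, e2]
    rw [mul_left_comm, ← zpow_one_add₀ hq0, ← zpow_add₀ hq0]
    congr 2
    push_cast
    linarith [two_mul_tri (j + 2 - 2 * n), two_mul_tri (n + j), two_mul_tri n, two_mul_tri j]
  have sT' (z : ℂ) (c : ℂ) : Summable fun j : ℤ => ‖(3 * (j : ℂ) + c) * T z j‖ := by
    refine (((sT z).2.mul_left 3).add ((sT z).1.mul_left ‖c‖)).of_nonneg_of_le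
      (fun _ => norm_nonneg _) fun j => ?_
    rw [add_mul]
    refine (norm_add_le _ _).trans (le_of_eq ?_)
    rw [mul_assoc, norm_mul, norm_mul c]
    norm_num [hT]
  have key : ∑' x : ℤ × ℤ, ((x.1 + 2 * x.2 : ℤ) : ℂ) * (A x.1 * B x.2) =
      (∑' j : ℤ, (3 * (j : ℂ) + 0) * T q j) * qPochInf (q ^ 2) (q ^ 2)
        - (∑' j : ℤ, (3 * (j : ℂ) + 1) * T (q ^ 2) j) * qPochInf (q ^ 2) (q ^ 2) := by
    rw [← finProdIntEquiv.tsum_eq, Summable.tsum_prod (by exact finProdIntEquiv.summable_iff.2 sF),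
      tsum_fintype, Fin.sum_univ_three]
    have f0 : ∑' y : ℤ × ℤ, (((finProdIntEquiv (0, y)).1 + 2 * (finProdIntEquiv (0, y)).2 : ℤ) : ℂ) *
        (A (finProdIntEquiv (0, y)).1 * B (finProdIntEquiv (0, y)).2) =
        (∑' j : ℤ, (3 * (j : ℂ) + 0) * T q j) * qPochInf (q ^ 2) (q ^ 2) := by
      rw [← P4, tsum_mul_tsum_of_summable_norm (sT' _ _) (sP _).1]
      refine tsum_congr fun y => ?_
      have := term0 y.1 y.2
      simp only [finProdIntEquiv, Equiv.coe_fn_mk, Fin.val_zero, Nat.cast_zero, add_zero, this]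
      push_cast; ring
    have f1 : ∑' y : ℤ × ℤ, (((finProdIntEquiv (1, y)).1 + 2 * (finProdIntEquiv (1, y)).2 : ℤ) : ℂ) *
        (A (finProdIntEquiv (1, y)).1 * B (finProdIntEquiv (1, y)).2) =
        -((∑' j : ℤ, (3 * (j : ℂ) + 1) * T (q ^ 2) j) * qPochInf (q ^ 2) (q ^ 2)) := by
      rw [← P2, tsum_mul_tsum_of_summable_norm (sT' _ _) (sP _).1, ← tsum_neg]
      refine tsum_congr fun y => ?_
      have := term1 y.1 y.2
      simp only [finProdIntEquiv, Equiv.coe_fn_mk, Fin.val_one, Nat.cast_one, this]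
      push_cast; ring
    have f2 : ∑' y : ℤ × ℤ, (((finProdIntEquiv (2, y)).1 + 2 * (finProdIntEquiv (2, y)).2 : ℤ) : ℂ) *
        (A (finProdIntEquiv (2, y)).1 * B (finProdIntEquiv (2, y)).2) =
        q * (∑' j : ℤ, (3 * (j : ℂ) + 2) * T (q ^ 3) j) * ∑' n, P (-1) n := by
      rw [mul_assoc, tsum_mul_tsum_of_summable_norm (sT' _ _) (sP _).1, ← tsum_mul_left]
      refine tsum_congr fun y => ?_
      have := term2 y.1 y.2
      simp only [finProdIntEquiv, Equiv.coe_fn_mk, Fin.val_two, Nat.cast_ofNat, this]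
      push_cast; ring
    rw [f0, f1, f2, P0]
    ring
  -- The reflection `j ↦ -j` carries the theta series at `q^2` to the one at `q`, so residues 0 and
  -- 1 combine into the weight `6 * j - 1`.
  have refl1 : ∑' j : ℤ, (3 * (j : ℂ) + 1) * T (q ^ 2) j =
      ∑' j : ℤ, T q j - 3 * ∑' j : ℤ, (j : ℂ) * T q j := by
    rw [← (Equiv.neg ℤ).tsum_eq, ← tsum_mul_left,
      ← (sT q).1.of_norm.tsum_sub ((sT q).2.of_norm.mul_left 3)]
    refine tsum_congr fun j => ?_
    have e : T (q ^ 2) (-j) = T q j := by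
      have e2 := pow_zpow_mul hq0 1 3 j (tri j)
      rw [pow_one] at e2
      simp only [hT, pow_zpow_mul hq0, e2]
      congr 1
      push_cast
      linarith [two_mul_tri (-j), two_mul_tri j]
    simp only [Equiv.neg_apply, e]
    push_cast; ring
  have refl0 : ∑' j : ℤ, (3 * (j : ℂ) + 0) * T q j = 3 * ∑' j : ℤ, (j : ℂ) * T q j := by
    rw [← tsum_mul_left]
    exact tsum_congr fun j => by ring
  rw [refl0, refl1, hF] at key
  linear_combination -key

end Theta

/-! ### From theta series to logarithmic derivatives -/

section Lambert

variable {q : ℂ}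

/-- `φ(-q)^3 / φ(-q^3)` as a difference of two logarithmic derivatives. -/
theorem ramanujanPhi_cube_div (hq : ‖q‖ < 1) :
    ramanujanPhi (-q) ^ 3 / ramanujanPhi (-q ^ 3) =
      1 - 6 * (gaussEulerDeriv q (q ^ 3) / qPochInf (-q) (q ^ 3))
        + 6 * (gaussEulerDeriv (q ^ 2) (q ^ 3) / qPochInf (-q ^ 2) (q ^ 3)) := by
  rcases eq_or_ne q 0 with rfl | hq0
  -- The triple product uses integer powers of `q`, so `q = 0` is separate; there both sides are
  -- `1`.
  · have h : gaussEulerDeriv 0 0 = 0 := by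
      rw [gaussEulerDeriv, ← tsum_zero (β := ℕ)]
      refine tsum_congr fun n => ?_
      rcases eq_or_ne n 0 with rfl | hn
      · simp
      · simp [hn]
    simp [ramanujanPhi_zero, h]
  have hq2 := norm_pow_lt_one hq (k := 2) (by norm_num)
  have hq3 := norm_pow_lt_one hq (k := 3) (by norm_num)
  have h3 := pow_ne_zero 3 hq0
  have e : q ^ 3 / q = q ^ 2 := by field_simp
  have theta := tsum_triple hq3 h3 hq0
  have theta' := tsum_mul_triple hq3 h3 hq0
  have quint := qPochInf_cube_mul_ramanujanPhi hq hq0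
  rw [e] at theta theta'
  rw [theta, theta'] at quint
  have phi1 := ramanujanPhi_neg hq hq0
  have phi3 := ramanujanPhi_neg hq3 h3
  have s1 := qPochInf_split_two hq q
  rw [← pow_two] at s1
  have s3 := qPochInf_split_two hq3 (q ^ 3)
  rw [← pow_two] at s3
  have t := qPochInf_split_three hq (-q)
  rw [neg_mul, neg_mul, ← pow_two, ← pow_succ'] at t
  have u1 := qPochInf_neg_self_mul hq
  have u3 := qPochInf_neg_self_mul hq3
  have n1 : qPochInf (-q) (q ^ 3) ≠ 0 := qPochInf_ne_zero hq3 (by rwa [norm_neg])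
  have n2 : qPochInf (-q ^ 2) (q ^ 3) ≠ 0 := qPochInf_ne_zero hq3 (by rwa [norm_neg])
  have n3 : qPochInf (q ^ 3) (q ^ 3) ≠ 0 := qPochInf_ne_zero hq3 hq3
  have n4 : qPochInf (q ^ 2) (q ^ 2) ≠ 0 := qPochInf_ne_zero hq2 hq2
  have n5 : ramanujanPhi (-q ^ 3) ≠ 0 := ramanujanPhi_neg_ne_zero hq3
  set a := qPochInf (-q) (q ^ 3)
  set b := qPochInf (-q ^ 2) (q ^ 3)
  set c := qPochInf (q ^ 3) (q ^ 3)
  set d := qPochInf (q ^ 2) (q ^ 2)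
  set o := qPochInf q (q ^ 2)
  set o3 := qPochInf (q ^ 3) ((q ^ 3) ^ 2)
  -- Both `a * b * o` and `o3` are inverse to `(-q^3;q^3)_∞`, by Euler's identity for `q` (dissected
  -- mod 3) and for `q^3`.
  have hab : a * b * o = o3 := by
    rw [t] at u1
    linear_combination o3 * u1 - a * b * o * u3
  have main : ramanujanPhi (-q) ^ 3 * (c * (a * b)) =
      (c * (a * b) - 6 * (c * (gaussEulerDeriv q (q ^ 3) * b - a * gaussEulerDeriv (q ^ 2) (q ^ 3))))
        * ramanujanPhi (-q ^ 3) := by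
    refine mul_left_cancel₀ n4 ?_
    rw [← mul_assoc d (_ - _), ← quint, phi3, phi1, s1]
    rw [← hab] at s3 ⊢
    rw [s3]
    ring
  field_simp
  refine mul_left_cancel₀ n3 ?_
  linear_combination main

end Lambert

/-! ### Matching exponents and summation ranges -/

section Main

lemma sq_eq_add_choose_two (n : ℕ) : n ^ 2 = n + 2 * n.choose 2 := by
  induction n with
  | zero => rfl
  | succ n ih => rw [choose_succ_two]; linarith

lemma gauss_term_sub (q c : ℂ) (n : ℕ) :
    (n : ℂ) * q ^ ((3 * n ^ 2 - n) / 2) / c = n * (q ^ n * (q ^ 3) ^ n.choose 2 / c) := by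
  have h : (3 * n ^ 2 - n) / 2 = n + 3 * n.choose 2 := by
    have := sq_eq_add_choose_two n
    omega
  rw [h, pow_add, pow_mul, mul_div_assoc]

lemma gauss_term_add (q c : ℂ) (n : ℕ) :
    (n : ℂ) * q ^ ((3 * n ^ 2 + n) / 2) / c = n * ((q ^ 2) ^ n * (q ^ 3) ^ n.choose 2 / c) := by
  have h : (3 * n ^ 2 + n) / 2 = 2 * n + 3 * n.choose 2 := by
    have := sq_eq_add_choose_two n
    omega
  rw [h, pow_add, pow_mul, pow_mul, mul_div_assoc]

lemma geom_term_one (q c : ℂ) (n : ℕ) :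
    (n : ℂ) * (-1) ^ n * q ^ n / c = n * ((-q) ^ n / c) := by
  rw [neg_pow q, mul_assoc, mul_div_assoc]

lemma geom_term_two (q c : ℂ) (n : ℕ) :
    (n : ℂ) * (-1) ^ n * q ^ (2 * n) / c = n * ((-q ^ 2) ^ n / c) := by
  rw [neg_pow (q ^ 2), pow_mul, mul_assoc, mul_div_assoc]

/-- The weight `n` annihilates the term at `0`. -/
lemma tsum_pnat_natCast_mul (f : ℕ → ℂ) :
    ∑' n : ℕ+, (n : ℂ) * f n = ∑' n : ℕ, (n : ℂ) * f n :=
  tsum_pnat_eq_tsum_of_eq_zero (f := fun n : ℕ => (n : ℂ) * f n) (by simp)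

/-- In every series the summation index is `n : ℕ+`, that is, `n = 1, 2, 3, …`; the exponents
`(3 * n ^ 2 ± n) / 2` are exact divisions of natural numbers. The first conjuncts say that all series
and products converge and that no denominator vanishes; the last two are the two identities. -/
theorem mainTheorem12 (q : ℂ) (hq : ‖q‖ < 1) :
    (Summable (fun n : ℤ => (-q) ^ (n ^ 2)) ∧
      Summable (fun n : ℤ => (-q ^ 3) ^ (n ^ 2)) ∧
      ramanujanPhi (-q ^ 3) ≠ 0) ∧
    (Multipliable (fun i : ℕ => 1 - (-q) * (q ^ 3) ^ i) ∧ qPochInf (-q) (q ^ 3) ≠ 0 ∧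
      Multipliable (fun i : ℕ => 1 - (-q ^ 2) * (q ^ 3) ^ i) ∧ qPochInf (-q ^ 2) (q ^ 3) ≠ 0) ∧
    (∀ n : ℕ, qPoch (q ^ 3) (q ^ 3) n ≠ 0) ∧
    (Summable (fun n : ℕ+ =>
        (n : ℂ) * q ^ ((3 * (n : ℕ) ^ 2 - (n : ℕ)) / 2) / qPoch (q ^ 3) (q ^ 3) n) ∧
      Summable (fun n : ℕ+ =>
        (n : ℂ) * q ^ ((3 * (n : ℕ) ^ 2 + (n : ℕ)) / 2) / qPoch (q ^ 3) (q ^ 3) n) ∧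
      Summable (fun n : ℕ+ =>
        (n : ℂ) * (-1) ^ (n : ℕ) * q ^ (n : ℕ) / qPoch (q ^ 3) (q ^ 3) n) ∧
      Summable (fun n : ℕ+ =>
        (n : ℂ) * (-1) ^ (n : ℕ) * q ^ (2 * (n : ℕ)) / qPoch (q ^ 3) (q ^ 3) n)) ∧
    ramanujanPhi (-q) ^ 3 / ramanujanPhi (-q ^ 3) =
      1 - 6 / qPochInf (-q) (q ^ 3) *
          ∑' n : ℕ+, (n : ℂ) * q ^ ((3 * (n : ℕ) ^ 2 - (n : ℕ)) / 2) / qPoch (q ^ 3) (q ^ 3) n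
        + 6 / qPochInf (-q ^ 2) (q ^ 3) *
          ∑' n : ℕ+, (n : ℂ) * q ^ ((3 * (n : ℕ) ^ 2 + (n : ℕ)) / 2) / qPoch (q ^ 3) (q ^ 3) n ∧
    ramanujanPhi (-q) ^ 3 / ramanujanPhi (-q ^ 3) =
      1 + 6 * qPochInf (-q) (q ^ 3) *
          (∑' n : ℕ+, (n : ℂ) * (-1) ^ (n : ℕ) * q ^ (n : ℕ) / qPoch (q ^ 3) (q ^ 3) n)
        - 6 * qPochInf (-q ^ 2) (q ^ 3) *
          ∑' n : ℕ+, (n : ℂ) * (-1) ^ (n : ℕ) * q ^ (2 * (n : ℕ)) / qPoch (q ^ 3) (q ^ 3) n := by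
  have hq2 := norm_pow_lt_one hq (k := 2) (by norm_num)
  have hq3 := norm_pow_lt_one hq (k := 3) (by norm_num)
  have hn1 : ‖-q‖ < 1 := by rwa [norm_neg]
  have hn2 : ‖-q ^ 2‖ < 1 := by rwa [norm_neg]
  have first := ramanujanPhi_cube_div hq
  have g (x : ℂ) := (summable_norm_div_qPoch hq3 (summable_gauss hq3 x)).2.of_norm
  have e {x : ℂ} (hx : ‖x‖ < 1) := (summable_norm_div_qPoch hq3 (summable_geom hx)).2.of_norm
  simp only [gauss_term_sub, gauss_term_add, geom_term_one, geom_term_two]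
  refine ⟨⟨summable_phi hq, summable_phi hq3, ramanujanPhi_neg_ne_zero hq3⟩,
    ⟨multipliable_qPoch hq3 _, qPochInf_ne_zero hq3 hn1, multipliable_qPoch hq3 _,
      qPochInf_ne_zero hq3 hn2⟩, qPoch_ne_zero hq3 hq3,
    ⟨(g _).comp_injective PNat.coe_injective, (g _).comp_injective PNat.coe_injective,
      (e hn1).comp_injective PNat.coe_injective, (e hn2).comp_injective PNat.coe_injective⟩, ?_, ?_⟩
  · rw [tsum_pnat_natCast_mul fun n => q ^ n * (q ^ 3) ^ n.choose 2 / qPoch (q ^ 3) (q ^ 3) n,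
      tsum_pnat_natCast_mul fun n => (q ^ 2) ^ n * (q ^ 3) ^ n.choose 2 / qPoch (q ^ 3) (q ^ 3) n,
      first, gaussEulerDeriv, gaussEulerDeriv]
    ring
  · rw [tsum_pnat_natCast_mul fun n => (-q) ^ n / qPoch (q ^ 3) (q ^ 3) n,
      tsum_pnat_natCast_mul fun n => (-q ^ 2) ^ n / qPoch (q ^ 3) (q ^ 3) n,
      first, gaussEulerDeriv_div hq3 hq, gaussEulerDeriv_div hq3 hq2, geomEulerDeriv,
      geomEulerDeriv]
    ring

end Main
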